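/- Let $\mathcal H$ be a real separable Hilbert space, let $\Omega\subset\mathcal H$ be open, and let $f:\Omega\to\mathbb R$. Let $\rho$ be a Borel probability measure on $\mathcal H$ such that for $\rho$-almost every $u$ one has $u\in\Omega$ and $f$ is Fréchet differentiable at $u$, with gradient $\nabla f(u)\in\mathcal H$ (the Riesz representative of $Df(u)$). Assume the moment condition $$\mathbb E\,\|\nabla f(U)\|^4<\infty,\qquad U\sim\rho .$$ For $a,b\in\mathcal H$ let $a\otimes b$ be the operator $h\mapsto\langle h,b\rangle a$. Let $\mathcal S_2(\mathcal H)$ be the separable Hilbert space of Hilbert–Schmidt operators on $\mathcal H$ with inner product $\langle S,T\rangle_{\mathcal S_2}=\sum_i\langle Se_i,Te_i\rangle$, $(e_i)$ any orthonormal basis of $\mathcal H$. Let $$\mathcal C:=\mathbb E\big[\nabla f(U)\otimes\nabla f(U)\big]$$ (a Bochner expectation in the bounded operators on $\mathcal H$), let $U_1,U_2,\dots$ be i.i.d. with law $\rho$, and for $B\ge 1$ let $$\widehat{\mathcal C}_B:=\frac1B\sum_{b=1}^B\nabla f(U_b)\otimes\nabla f(U_b).$$ **Theorem (Hilbert-space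 CLT in $\mathcal S_2(\mathcal H)$).** The operator $\mathcal C$ is well defined and belongs to $\mathcal S_2(\mathcal H)$, and in $\mathcal S_2(\mathcal H)$, with its Hilbert–Schmidt norm topology, $$\sqrt B\,\big(\widehat{\mathcal C}_B-\mathcal C\big)\ \Rightarrow\ Z_\infty\qquad(B\to\infty)$$ in distribution, where $Z_\infty$ is a mean-zero Gaussian element of $\mathcal S_2(\mathcal H)$ whose covariance operator $\Gamma:\mathcal S_2(\mathcal H)\to\mathcal S_2(\mathcal H)$ is the Bochner expectation $$\Gamma=\mathbb E\big[X\otimes X\big],\qquad X:=\nabla f(U)\otimes\nabla f(U)-\mathcal C,$$ where the outer tensor product is that of $\mathcal S_2(\mathcal H)$; that is, $\langle\Gamma S,T\rangle_{\mathcal S_2}=\mathbb E\big[\langle X,S\rangle_{\mathcal S_2}\langle X,T\rangle_{\mathcal S_2}\big]$ for all $S,T\in\mathcal S_2(\mathcal H)$. -/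

import Mathlib

open MeasureTheory ProbabilityTheory Filter Topology InnerProductSpace
open scoped RealInnerProductSpace Gradient

section HilbertSchmidtSpace

theorem hilbertBasis_tsum_ofReal {H : Type*} [NormedAddCommGroup H] [InnerProductSpace ℝ H]
    {ι : Type*} (b : HilbertBasis ι ℝ H) (x : H) :
    ∑' i, ENNReal.ofReal (⟪b i, x⟫ ^ 2) = ENNReal.ofReal (‖x‖ ^ 2) := by
  have h := b.hasSum_inner_mul_inner x x
  have h2 : (fun i => ⟪x, b i⟫ * ⟪b i, x⟫) = fun i => ⟪b i, x⟫ ^ 2 := by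
    funext i
    rw [real_inner_comm, sq]
  rw [h2, real_inner_self_eq_norm_sq] at h
  rw [← h.tsum_eq, ENNReal.ofReal_tsum_of_nonneg (fun _ => sq_nonneg _) h.summable]

variable {H : Type*} [NormedAddCommGroup H] [InnerProductSpace ℝ H] [CompleteSpace H]

theorem tsum_ofReal_norm_sq_adjoint {ι κ : Type*} (b : HilbertBasis ι ℝ H)
    (c : HilbertBasis κ ℝ H) (T : H →L[ℝ] H) :
    ∑' i, ENNReal.ofReal (‖T (b i)‖ ^ 2)
      = ∑' j, ENNReal.ofReal (‖ContinuousLinearMap.adjoint T (c j)‖ ^ 2) := by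
  simp_rw [← hilbertBasis_tsum_ofReal c (T _), ← hilbertBasis_tsum_ofReal b (_ : H)]
  rw [ENNReal.tsum_comm]
  refine tsum_congr fun j => tsum_congr fun i => ?_
  rw [ContinuousLinearMap.adjoint_inner_right, real_inner_comm]

theorem summable_iff_tsum_ofReal {ι : Type*} {f : ι → ℝ} (hf : ∀ i, 0 ≤ f i) :
    Summable f ↔ ∑' i, ENNReal.ofReal (f i) ≠ ⊤ := by
  refine ⟨fun h => ?_, fun h => ?_⟩
  · rw [← ENNReal.ofReal_tsum_of_nonneg hf h]
    exact ENNReal.ofReal_ne_top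
  · have := ENNReal.summable_toReal h
    simpa [ENNReal.toReal_ofReal (hf _)] using this

variable (H) in
/-- The index set of a fixed orthonormal (Hilbert) basis of `H`. -/
noncomputable def hsIndex : Set H := (exists_hilbertBasis ℝ H).choose

variable (H) in
/-- A fixed orthonormal (Hilbert) basis of `H`. -/
noncomputable def hsBasis : HilbertBasis (hsIndex H) ℝ H :=
  (exists_hilbertBasis ℝ H).choose_spec.choose

/-- A bounded operator `T` is Hilbert–Schmidt if `∑ i, ‖T eᵢ‖ ^ 2 < ∞` for an orthonormal basis
`(eᵢ)`; the choice of basis is irrelevant, see `isHilbertSchmidt_iff`. -/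
def IsHilbertSchmidt (T : H →L[ℝ] H) : Prop :=
  Summable fun i => ‖T (hsBasis H i)‖ ^ 2

theorem isHilbertSchmidt_iff {ι : Type*} (b : HilbertBasis ι ℝ H) (T : H →L[ℝ] H) :
    IsHilbertSchmidt T ↔ Summable fun i => ‖T (b i)‖ ^ 2 := by
  rw [IsHilbertSchmidt, summable_iff_tsum_ofReal (fun _ => sq_nonneg _),
    summable_iff_tsum_ofReal (fun _ => sq_nonneg _), tsum_ofReal_norm_sq_adjoint (hsBasis H) b T,
    tsum_ofReal_norm_sq_adjoint b b T]

theorem IsHilbertSchmidt.summable_inner {S T : H →L[ℝ] H} (hS : IsHilbertSchmidt S)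
    (hT : IsHilbertSchmidt T) {ι : Type*} (b : HilbertBasis ι ℝ H) :
    Summable fun i => ⟪S (b i), T (b i)⟫ := by
  rw [isHilbertSchmidt_iff b] at hS hT
  refine Summable.of_norm_bounded (hS.add hT) fun i => ?_
  have h := norm_inner_le_norm (𝕜 := ℝ) (S (b i)) (T (b i))
  nlinarith [sq_nonneg (‖S (b i)‖ - ‖T (b i)‖), sq_nonneg (‖S (b i)‖), sq_nonneg (‖T (b i)‖)]

theorem IsHilbertSchmidt.add {S T : H →L[ℝ] H} (hS : IsHilbertSchmidt S)
    (hT : IsHilbertSchmidt T) : IsHilbertSchmidt (S + T) := by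
  have h := (Summable.add hS hT).mul_left 2
  refine Summable.of_nonneg_of_le (fun _ => sq_nonneg _) (fun i => ?_) h
  have h1 := norm_add_le (S (hsBasis H i)) (T (hsBasis H i))
  have h2 := norm_nonneg (S (hsBasis H i) + T (hsBasis H i))
  rw [add_apply]
  nlinarith [sq_nonneg (‖S (hsBasis H i)‖ - ‖T (hsBasis H i)‖)]

theorem IsHilbertSchmidt.smul {T : H →L[ℝ] H} (c : ℝ) (hT : IsHilbertSchmidt T) :
    IsHilbertSchmidt (c • T) := by
  have h := Summable.mul_left (‖c‖ ^ 2) hT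
  refine h.congr fun i => ?_
  rw [smul_apply, norm_smul, mul_pow]

theorem isHilbertSchmidt_zero : IsHilbertSchmidt (0 : H →L[ℝ] H) := by
  simp [IsHilbertSchmidt]

/-- Rank-one operators `x ⊗ y : h ↦ ⟪y, h⟫ x` are Hilbert–Schmidt. -/
theorem isHilbertSchmidt_rankOne (x y : H) : IsHilbertSchmidt (rankOne ℝ x y) := by
  have h := (hsBasis H).summable_inner_mul_inner y y
  refine (h.mul_right (‖x‖ ^ 2)).congr fun i => ?_
  rw [rankOne_apply, norm_smul, mul_pow, Real.norm_eq_abs, sq_abs,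
    real_inner_comm (hsBasis H i) y, sq ⟪hsBasis H i, y⟫]

variable (H) in
/-- The linear subspace of Hilbert–Schmidt operators. -/
def hsSubmodule : Submodule ℝ (H →L[ℝ] H) where
  carrier := {T | IsHilbertSchmidt T}
  add_mem' := IsHilbertSchmidt.add
  zero_mem' := isHilbertSchmidt_zero
  smul_mem' := fun c _ => IsHilbertSchmidt.smul c

variable (H) in
/-- The space `S₂(H)` of Hilbert–Schmidt operators on `H`. It is a type of its own, so that its
norm is the Hilbert–Schmidt norm and not the operator norm. -/
def HilbertSchmidt : Type _ := ↥(hsSubmodule H)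

namespace HilbertSchmidt

noncomputable instance : AddCommGroup (HilbertSchmidt H) :=
  inferInstanceAs (AddCommGroup ↥(hsSubmodule H))

noncomputable instance : Module ℝ (HilbertSchmidt H) :=
  inferInstanceAs (Module ℝ ↥(hsSubmodule H))

/-- The bounded operator underlying an element of `S₂(H)`. -/
noncomputable def toCLM : HilbertSchmidt H →ₗ[ℝ] (H →L[ℝ] H) := (hsSubmodule H).subtype

/-- A Hilbert–Schmidt operator as an element of `S₂(H)`. -/
def mk (T : H →L[ℝ] H) (hT : IsHilbertSchmidt T) : HilbertSchmidt H := ⟨T, hT⟩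

@[simp]
theorem toCLM_mk (T : H →L[ℝ] H) (hT : IsHilbertSchmidt T) : toCLM (mk T hT) = T := rfl

theorem isHilbertSchmidt (A : HilbertSchmidt H) : IsHilbertSchmidt (toCLM A) := A.2

theorem toCLM_injective : Function.Injective (toCLM : HilbertSchmidt H → H →L[ℝ] H) :=
  Subtype.val_injective

theorem ext_basis {A : HilbertSchmidt H} (h : ∀ i, toCLM A (hsBasis H i) = 0) : A = 0 := by
  apply toCLM_injective
  rw [map_zero]
  ext x
  have hx := ((hsBasis H).hasSum_repr x).mapL (toCLM A)
  simp only [map_smul, h, smul_zero] at hx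
  exact hx.unique hasSum_zero

/-- The Hilbert–Schmidt inner product `⟪A, B⟫ = ∑ i, ⟪A eᵢ, B eᵢ⟫`. -/
noncomputable instance core : InnerProductSpace.Core ℝ (HilbertSchmidt H) where
  inner A B := ∑' i, ⟪toCLM A (hsBasis H i), toCLM B (hsBasis H i)⟫
  conj_inner_symm A B := by
    simp only [conj_trivial]
    exact tsum_congr fun i => real_inner_comm _ _
  re_inner_nonneg A := by
    simp only [RCLike.re_to_real]
    exact tsum_nonneg fun i => real_inner_self_nonneg
  add_left A B C := by
    simp only [map_add, add_apply, inner_add_left]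
    exact (A.isHilbertSchmidt.summable_inner C.isHilbertSchmidt _).tsum_add
      (B.isHilbertSchmidt.summable_inner C.isHilbertSchmidt _)
  smul_left A B r := by
    simp only [map_smul, smul_apply, real_inner_smul_left, conj_trivial]
    exact tsum_mul_left
  definite A h := by
    refine ext_basis fun i => ?_
    have hs := A.isHilbertSchmidt.summable_inner A.isHilbertSchmidt (hsBasis H)
    have h0 := (hs.hasSum_iff.2 h)
    rw [hasSum_zero_iff_of_nonneg (fun i => real_inner_self_nonneg)] at h0
    exact inner_self_eq_zero.1 (congrFun h0 i)

noncomputable instance : NormedAddCommGroup (HilbertSchmidt H) :=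
  core.toNormedAddCommGroup

noncomputable instance : InnerProductSpace ℝ (HilbertSchmidt H) :=
  InnerProductSpace.ofCore core.toCore

theorem inner_def (A B : HilbertSchmidt H) :
    ⟪A, B⟫ = ∑' i, ⟪toCLM A (hsBasis H i), toCLM B (hsBasis H i)⟫ := rfl

theorem norm_sq_ofReal {ι : Type*} (b : HilbertBasis ι ℝ H) (A : HilbertSchmidt H) :
    ENNReal.ofReal (‖A‖ ^ 2) = ∑' i, ENNReal.ofReal (‖toCLM A (b i)‖ ^ 2) := by
  rw [tsum_ofReal_norm_sq_adjoint b b, ← tsum_ofReal_norm_sq_adjoint (hsBasis H) b,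
    ← real_inner_self_eq_norm_sq, inner_def]
  simp_rw [real_inner_self_eq_norm_sq]
  exact ENNReal.ofReal_tsum_of_nonneg (fun _ => sq_nonneg _) A.isHilbertSchmidt

/-- The Hilbert–Schmidt norm does not depend on the orthonormal basis. -/
theorem norm_sq_eq_tsum {ι : Type*} (b : HilbertBasis ι ℝ H) (A : HilbertSchmidt H) :
    ‖A‖ ^ 2 = ∑' i, ‖toCLM A (b i)‖ ^ 2 := by
  have hs := (isHilbertSchmidt_iff b _).1 A.isHilbertSchmidt
  rw [← ENNReal.ofReal_eq_ofReal_iff (sq_nonneg _) (tsum_nonneg fun _ => sq_nonneg _),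
    norm_sq_ofReal b, ENNReal.ofReal_tsum_of_nonneg (fun _ => sq_nonneg _) hs]

theorem norm_toCLM_le (A : HilbertSchmidt H) : ‖toCLM A‖ ≤ ‖A‖ := by
  refine ContinuousLinearMap.opNorm_le_bound _ (norm_nonneg _) fun x => ?_
  have h : ENNReal.ofReal (‖toCLM A x‖ ^ 2) ≤ ENNReal.ofReal ((‖A‖ * ‖x‖) ^ 2) := by
    rw [mul_pow, ENNReal.ofReal_mul (sq_nonneg _), norm_sq_ofReal (hsBasis H),
      tsum_ofReal_norm_sq_adjoint (hsBasis H) (hsBasis H), ← ENNReal.tsum_mul_right,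
      ← hilbertBasis_tsum_ofReal (hsBasis H)]
    refine ENNReal.tsum_le_tsum fun i => ?_
    rw [← ENNReal.ofReal_mul (sq_nonneg _), ← mul_pow, ← ContinuousLinearMap.adjoint_inner_left]
    refine ENNReal.ofReal_le_ofReal (sq_le_sq.2 ?_)
    rw [abs_of_nonneg (a := _ * _) (by positivity)]
    exact abs_real_inner_le_norm _ _
  rw [ENNReal.ofReal_le_ofReal_iff (sq_nonneg _)] at h
  exact (pow_le_pow_iff_left₀ (norm_nonneg _) (by positivity) two_ne_zero).1 h

/-- The isometric embedding `A ↦ (A eᵢ)ᵢ` of `S₂(H)` into `ℓ²(H)`. -/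
noncomputable def toLp (A : HilbertSchmidt H) : lp (fun _ : hsIndex H => H) 2 :=
  ⟨fun i => toCLM A (hsBasis H i), by
    have h := A.isHilbertSchmidt
    refine (memℓp_gen_iff (E := fun _ : hsIndex H => H) (p := 2) (by norm_num)).2 ?_
    simpa [IsHilbertSchmidt] using h⟩

theorem toLp_apply (A : HilbertSchmidt H) (i : hsIndex H) :
    toLp A i = toCLM A (hsBasis H i) := rfl

theorem dist_toLp (A B : HilbertSchmidt H) : dist (toLp A) (toLp B) = dist A B := by
  have hsub : toLp A - toLp B = toLp (A - B) := by
    ext i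
    rw [lp.coeFn_sub, Pi.sub_apply, toLp_apply, toLp_apply, toLp_apply, map_sub, sub_apply]
  rw [dist_eq_norm, dist_eq_norm, hsub,
    ← sq_eq_sq₀ (norm_nonneg _) (norm_nonneg _), norm_sq_eq_tsum (hsBasis H)]
  have h := lp.norm_rpow_eq_tsum (p := 2) (by norm_num) (toLp (A - B))
  simpa [toLp_apply] using h

instance : CompleteSpace (HilbertSchmidt H) := by
  refine Metric.complete_of_cauchySeq_tendsto fun u hu => ?_
  have hlp : CauchySeq fun n => toLp (u n) :=
    (Isometry.of_dist_eq dist_toLp).uniformContinuous.comp_cauchySeq hu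
  have hop : CauchySeq fun n => toCLM (u n) := by
    refine LipschitzWith.uniformContinuous (K := 1) ?_ |>.comp_cauchySeq hu
    refine LipschitzWith.of_dist_le_mul fun A B => ?_
    rw [dist_eq_norm, dist_eq_norm, ← map_sub]
    simpa using norm_toCLM_le (A - B)
  obtain ⟨v, hv⟩ := cauchySeq_tendsto_of_complete hlp
  obtain ⟨T, hT⟩ := cauchySeq_tendsto_of_complete hop
  have hTv : ∀ i, T (hsBasis H i) = v i := fun i => by
    refine tendsto_nhds_unique (f := fun n => toCLM (u n) (hsBasis H i)) (l := atTop) ?_ ?_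
    · exact ((ContinuousLinearMap.apply ℝ H (hsBasis H i)).continuous.tendsto T).comp hT
    · exact ((lp.evalCLM ℝ (fun _ : hsIndex H => H) 2 i).continuous.tendsto v).comp hv
  have hHS : IsHilbertSchmidt T := by
    have h := (memℓp_gen_iff (p := 2) (by norm_num)).1 v.2
    simpa [IsHilbertSchmidt, hTv] using h
  refine ⟨mk T hHS, ?_⟩
  have hv' : toLp (mk T hHS) = v := by
    ext i
    exact hTv i
  rw [tendsto_iff_dist_tendsto_zero] at hv ⊢
  simpa [← hv', dist_toLp] using hv

/-- `S₂(H)` carries the Borel σ-algebra of the Hilbert–Schmidt norm. -/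
noncomputable instance : MeasurableSpace (HilbertSchmidt H) := borel _

instance : BorelSpace (HilbertSchmidt H) := ⟨rfl⟩

instance [TopologicalSpace.SeparableSpace H] : Countable (hsIndex H) := by
  have hd : Pairwise (Function.onFun Disjoint fun i => Metric.ball (hsBasis H i) (1 / 2)) := by
    intro i j hij
    refine Metric.ball_disjoint_ball ?_
    have ho := (hsBasis H).orthonormal
    have h2 : dist (hsBasis H i) (hsBasis H j) ^ 2 = 2 := by
      rw [dist_eq_norm, norm_sub_sq_real, ho.1, ho.1, ho.2 hij]
      norm_num
    nlinarith [dist_nonneg (x := hsBasis H i) (y := hsBasis H j)]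
  exact hd.countable_of_isOpen_disjoint (fun _ => Metric.isOpen_ball)
    (fun _ => Metric.nonempty_ball.2 (by norm_num))

/-- `S₂(H)` is separable when `H` is. -/
instance [TopologicalSpace.SeparableSpace H] :
    TopologicalSpace.SeparableSpace (HilbertSchmidt H) := by
  classical
  let S : Set (lp (fun _ : hsIndex H => H) 2) :=
    ⋃ i, Set.range (lp.singleContinuousLinearMap ℝ (fun _ : hsIndex H => H) 2 i)
  have hS0 : TopologicalSpace.IsSeparable S :=
    .iUnion fun i => TopologicalSpace.isSeparable_range (ContinuousLinearMap.continuous _)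
  have hS := (hS0.span (R := ℝ)).closure
  have hlp : TopologicalSpace.SeparableSpace (lp (fun _ : hsIndex H => H) 2) := by
    refine TopologicalSpace.isSeparable_univ_iff.1 (hS.mono fun v _ => ?_)
    refine mem_closure_of_tendsto (lp.hasSum_single (p := 2) (by norm_num) v)
      (Eventually.of_forall fun s => ?_)
    exact Submodule.sum_mem _ fun i _ =>
      Submodule.subset_span (Set.mem_iUnion.2 ⟨i, v i, rfl⟩)
  have := UniformSpace.secondCountable_of_separable (lp (fun _ : hsIndex H => H) 2)
  have := (Isometry.of_dist_eq (dist_toLp (H := H))).isEmbedding.secondCountableTopology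
  infer_instance

/-- The tensor product `g ⊗ g : h ↦ ⟪h, g⟫ g`, as an element of `S₂(H)`. -/
noncomputable def tensorSelf (g : H) : HilbertSchmidt H :=
  mk (rankOne ℝ g g) (isHilbertSchmidt_rankOne g g)

end HilbertSchmidt

end HilbertSchmidtSpace

section ActiveSubspace

variable {H : Type*} [NormedAddCommGroup H] [InnerProductSpace ℝ H] [CompleteSpace H]

/-- The active subspace operator `C = E[∇f(U) ⊗ ∇f(U)]`, `U ∼ ρ`, as a Bochner integral in the
space of bounded operators. -/
noncomputable def activeSubspaceOperator [MeasurableSpace H] (f : H → ℝ) (ρ : Measure H) :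
    H →L[ℝ] H :=
  ∫ u, rankOne ℝ (∇ f u) (∇ f u) ∂ρ

/-- The Monte Carlo estimator `(1/B) ∑ gᵦ ⊗ gᵦ`, `gᵦ = ∇f(uᵦ)`, formed from the first `B` terms of
a sequence `u` of sample points, as an element of `S₂(H)`. -/
noncomputable def empiricalOperator (f : H → ℝ) (u : ℕ → H) (B : ℕ) : HilbertSchmidt H :=
  (B : ℝ)⁻¹ • ∑ b ∈ Finset.range B, HilbertSchmidt.tensorSelf (∇ f (u b))

theorem toCLM_empiricalOperator (f : H → ℝ) (u : ℕ → H) (B : ℕ) :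
    (empiricalOperator f u B).toCLM =
      (B : ℝ)⁻¹ • ∑ b ∈ Finset.range B, rankOne ℝ (∇ f (u b)) (∇ f (u b)) := by
  simp [empiricalOperator, HilbertSchmidt.tensorSelf]

end ActiveSubspace

/-! The rank-one identity `‖g ⊗ g‖ = ‖g‖ ^ 2` in the Hilbert–Schmidt norm turns the fourth moment of
the gradient into a second moment of `X = ∇f ⊗ ∇f - C` in the separable Hilbert space `S₂(H)`. What
remains is the central limit theorem for centred, square-integrable i.i.d. variables in such a
space, `exists_isGaussian_tendstoInDistribution_inv_sqrt_smul_sum`.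

That theorem combines tightness with convergence of characteristic functions. Independent centred
variables are orthogonal in `L²`, so a normalised sum has second moment at most that of one summand.
The same holds after projecting off a finite-dimensional subspace, which makes the tails uniformly
small (`isTightMeasureSet_map_inv_sqrt_smul_sum`). The real central limit theorem for `⟪t, X k⟫`
gives the characteristic functions. The Gaussian limit is not built by hand: it is a cluster point
supplied by Prokhorov's theorem and identified by its characteristic function. -/

/-! ### Tightness criterion in a Hilbert space. -/

open scoped ENNReal in
theorem isTightMeasureSet_of_lintegral_sub_starProjection {E : Type*} [NormedAddCommGroup E]
    [InnerProductSpace ℝ E] [CompleteSpace E] [MeasurableSpace E] [BorelSpace E]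
    {S : Set (Measure E)} {M : ℝ≥0∞} (hM : M ≠ ⊤)
    (hbound : ∀ μ ∈ S, ∫⁻ x, ‖x‖ₑ ^ 2 ∂μ ≤ M)
    (happrox : ∀ ε : ℝ≥0∞, 0 < ε → ∃ (V : Submodule ℝ E) (_ : FiniteDimensional ℝ V),
      ∀ μ ∈ S, ∫⁻ x, ‖x - V.starProjection x‖ₑ ^ 2 ∂μ ≤ ε) :
    IsTightMeasureSet S := by
  rw [isTightMeasureSet_iff_exists_isCompact_measure_compl_le]
  intro ε hε
  have hε2 : ε / 2 ≠ 0 := (ENNReal.half_pos hε.ne').ne'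
  -- Half of `ε` goes to Markov's inequality for the norm, hence `M < N * (ε / 2)`; the other half
  -- is split into the summable `e n`.
  obtain ⟨N, hN⟩ := ENNReal.exists_nat_mul_gt hε2 hM
  obtain ⟨e, he0, hesum⟩ := ENNReal.exists_pos_sum_of_countable' hε2 ℕ
  have hpos (n : ℕ) : (0 : ℝ≥0∞) < (n + 1 : ℝ≥0∞)⁻¹ ^ 2 :=
    ENNReal.pow_pos (ENNReal.inv_pos.2 (by finiteness)) 2
  -- With this bound, Chebyshev at level `1 / (n + 1)` leaves mass at most `e n` outside `A n`.
  choose V hfin hV using fun n : ℕ =>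
    happrox ((n + 1 : ℝ≥0∞)⁻¹ ^ 2 * e n) (ENNReal.mul_pos (hpos n).ne' (he0 n).ne')
  set A : ℕ → Set E := fun n => {x | ‖x - (V n).starProjection x‖ₑ ≤ (n + 1 : ℝ≥0∞)⁻¹}
  set B : Set E := {x | ‖x‖ₑ ^ 2 ≤ N}
  refine ⟨B ∩ ⋂ n, A n, ?_, fun μ hμ => ?_⟩
  · have hBclosed : IsClosed B := isClosed_le (by fun_prop) continuous_const
    have hAclosed (n : ℕ) : IsClosed (A n) := isClosed_le (by fun_prop) continuous_const
    refine isCompact_iff_totallyBounded_isComplete.2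
      ⟨?_, (hBclosed.inter (isClosed_iInter hAclosed)).isComplete⟩
    refine Metric.totallyBounded_iff.2 fun η hη => ?_
    obtain ⟨n, hn⟩ := exists_nat_one_div_lt (half_pos hη)
    -- Points of the set lie within `η / 2` of a ball in the finite-dimensional `V n`, so a finite
    -- `η / 2`-net of that ball is an `η`-net of the set.
    have hcomp : IsCompact ((↑) '' Metric.closedBall (0 : V n) √N : Set E) :=
      (isCompact_closedBall _ _).image continuous_subtype_val
    obtain ⟨t, ht, hcover⟩ := Metric.totallyBounded_iff.1 hcomp.totallyBounded _ (half_pos hη)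
    refine ⟨t, ht, fun x hx => ?_⟩
    have hxB : ‖x‖ ^ 2 ≤ N := by
      have h : ‖x‖ₑ ^ 2 ≤ N := hx.1
      rw [← ofReal_norm, ← ENNReal.ofReal_pow (norm_nonneg _)] at h
      simpa using ENNReal.toReal_mono (by finiteness) h
    have hxA : ‖x - (V n).starProjection x‖ ≤ 1 / ((n : ℝ) + 1) := by
      have h : ‖x - (V n).starProjection x‖ₑ ≤ (n + 1 : ℝ≥0∞)⁻¹ := Set.mem_iInter.1 hx.2 n
      have h' := ENNReal.toReal_mono (by simp) h
      rw [toReal_enorm] at h'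
      refine h'.trans_eq ?_
      rw [ENNReal.toReal_inv, ENNReal.toReal_add (by finiteness) (by finiteness)]
      simp
    have hmem : (V n).starProjection x ∈ ((↑) '' Metric.closedBall (0 : V n) √N : Set E) := by
      refine ⟨(V n).orthogonalProjectionOnto x, ?_, rfl⟩
      rw [mem_closedBall_zero_iff]
      exact ((V n).norm_orthogonalProjectionOnto_apply_le x).trans (Real.le_sqrt_of_sq_le hxB)
    obtain ⟨y, hy, hxy⟩ := Set.mem_iUnion₂.1 (hcover hmem)
    refine Set.mem_iUnion₂.2 ⟨y, hy, ?_⟩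
    rw [Metric.mem_ball] at hxy ⊢
    calc dist x y ≤ dist x ((V n).starProjection x) + dist ((V n).starProjection x) y :=
          dist_triangle _ _ _
      _ < η / 2 + η / 2 := by
          rw [dist_eq_norm x]
          exact add_lt_add (hxA.trans_lt hn) hxy
      _ = η := add_halves η
  · have hBc : μ Bᶜ ≤ ε / 2 := by
      calc μ Bᶜ ≤ μ {x | (N : ℝ≥0∞) ≤ ‖x‖ₑ ^ 2} :=
            measure_mono fun x (hx : ¬ ‖x‖ₑ ^ 2 ≤ N) => (not_le.1 hx).le
        _ ≤ (∫⁻ x, ‖x‖ₑ ^ 2 ∂μ) / N := by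
            refine meas_ge_le_lintegral_div (by fun_prop) ?_ (by finiteness)
            rintro h
            simp [h] at hN
        _ ≤ ε / 2 := ENNReal.div_le_of_le_mul <| (hbound μ hμ).trans <| by
            rw [mul_comm]; exact hN.le
    have hAc (n : ℕ) : μ (A n)ᶜ ≤ e n := by
      calc μ (A n)ᶜ ≤ μ {x | (n + 1 : ℝ≥0∞)⁻¹ ^ 2 ≤ ‖x - (V n).starProjection x‖ₑ ^ 2} :=
            measure_mono fun x (hx : ¬ _ ≤ _) => pow_le_pow_left' (not_le.1 hx).le 2
        _ ≤ (∫⁻ x, ‖x - (V n).starProjection x‖ₑ ^ 2 ∂μ) / (n + 1 : ℝ≥0∞)⁻¹ ^ 2 :=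
            meas_ge_le_lintegral_div
              (by fun_prop : Continuous _).measurable.aemeasurable (hpos n).ne' (by finiteness)
        _ ≤ e n := ENNReal.div_le_of_le_mul <| (hV n μ hμ).trans_eq (mul_comm _ _)
    calc μ (B ∩ ⋂ n, A n)ᶜ ≤ μ Bᶜ + μ (⋃ n, (A n)ᶜ) := by
          rw [Set.compl_inter, Set.compl_iInter]
          exact measure_union_le _ _
      _ ≤ ε / 2 + ∑' n, e n :=
          add_le_add hBc ((measure_iUnion_le _).trans (ENNReal.tsum_le_tsum hAc))
      _ ≤ ε / 2 + ε / 2 := by gcongr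
      _ = ε := ENNReal.add_halves ε

/-! ### Second moments of independent sums and finite-dimensional approximation. -/

section SecondMoment

variable {Ω : Type*} {mΩ : MeasurableSpace Ω} {P : Measure Ω} [IsProbabilityMeasure P]
  {E : Type*} [NormedAddCommGroup E] [InnerProductSpace ℝ E] [CompleteSpace E]
  [SecondCountableTopology E] [MeasurableSpace E] [BorelSpace E]

omit [IsProbabilityMeasure P] [SecondCountableTopology E] in
theorem ProbabilityTheory.IndepFun.integral_inner_eq_zero {X Y : Ω → E} (h : IndepFun X Y P)
    (hX : Integrable X P) (hY : Integrable Y P) (h0 : ∫ ω, Y ω ∂P = 0) :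
    ∫ ω, ⟪X ω, Y ω⟫ ∂P = 0 := by
  have := h.integral_bilin hX hY (innerSL ℝ)
  rw [h0, map_zero] at this
  exact this

/-- Pythagoras in `L²`: by independence the cross terms are inner products of means, which vanish.
-/
theorem ProbabilityTheory.iIndepFun.integral_norm_sq_sum {ι : Type*} {X : ι → Ω → E}
    (hindep : iIndepFun X P) (hX : ∀ i, MemLp (X i) 2 P) (h0 : ∀ i, ∫ ω, X i ω ∂P = 0)
    (s : Finset ι) :
    ∫ ω, ‖∑ i ∈ s, X i ω‖ ^ 2 ∂P = ∑ i ∈ s, ∫ ω, ‖X i ω‖ ^ 2 ∂P := by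
  classical
  induction s using Finset.induction_on with
  | empty => simp
  | insert i s hi ih =>
    have hsum : MemLp (fun ω => ∑ j ∈ s, X j ω) 2 P := memLp_finsetSum s fun j _ => hX j
    have hind : IndepFun (fun ω => ∑ j ∈ s, X j ω) (X i) P := by
      have := hindep.indepFun_finsetSum_of_notMem₀ (fun j => (hX j).aemeasurable) hi
      convert this using 1
      ext ω
      simp
    have hinner := hind.integral_inner_eq_zero (hsum.integrable (by simp))
      ((hX i).integrable (by simp)) (h0 i)
    have hint : Integrable (fun ω => ⟪∑ j ∈ s, X j ω, X i ω⟫) P :=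
      hind.integrable_bilin
      (hsum.integrable (by simp)) ((hX i).integrable (by simp)) (innerSL ℝ)
    rw [Finset.sum_insert hi, ← ih]
    simp_rw [Finset.sum_insert hi, add_comm (X i _), norm_add_sq_real]
    have h1 := hsum.integrable_norm_pow'
    rw [integral_add (by exact h1.add (hint.const_mul 2)) (hX i).integrable_norm_pow',
      integral_add h1 (hint.const_mul 2), integral_const_mul, hinner]
    ring

end SecondMoment

theorem lintegral_enorm_sq_eq_ofReal_integral {Ω E : Type*} {mΩ : MeasurableSpace Ω}
    {P : Measure Ω} [IsFiniteMeasure P] [NormedAddCommGroup E] {X : Ω → E} (hX : MemLp X 2 P) :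
    ∫⁻ ω, ‖X ω‖ₑ ^ 2 ∂P = ENNReal.ofReal (∫ ω, ‖X ω‖ ^ 2 ∂P) := by
  rw [ofReal_integral_eq_lintegral_ofReal hX.integrable_norm_pow' (ae_of_all _ fun _ => sq_nonneg _)]
  simp_rw [ENNReal.ofReal_pow (norm_nonneg _), ofReal_norm]

-- Simple functions are dense in `L²` and take values in a finite-dimensional span; projecting onto
-- that span approximates `X` at least as well as the simple function does.
open scoped ENNReal in
theorem MeasureTheory.MemLp.exists_finiteDimensional_lintegral_sub_starProjection_le
    {Ω E : Type*} {mΩ : MeasurableSpace Ω} {P : Measure Ω} [NormedAddCommGroup E]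
    [InnerProductSpace ℝ E] {X : Ω → E} (hX : MemLp X 2 P) {ε : ℝ≥0∞} (hε : 0 < ε) :
    ∃ (V : Submodule ℝ E) (_ : FiniteDimensional ℝ V),
      ∫⁻ ω, ‖X ω - V.starProjection (X ω)‖ₑ ^ 2 ∂P ≤ ε := by
  obtain ⟨δ, hδ, hδε⟩ : ∃ δ : ℝ≥0∞, 0 < δ ∧ δ ^ 2 ≤ ε := by
    -- Capping at `1` gives `δ ^ 2 ≤ δ ≤ ε`.
    refine ⟨min ε 1, lt_min hε one_pos, ?_⟩
    rw [sq]
    exact (mul_le_mul' (min_le_left _ _) (min_le_right _ _)).trans_eq (mul_one _)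
  obtain ⟨g, hg, -⟩ := hX.exists_simpleFunc_eLpNorm_sub_lt (by simp) hδ.ne'
  have hfin : FiniteDimensional ℝ (Submodule.span ℝ (Set.range g)) :=
    FiniteDimensional.span_of_finite ℝ g.finite_range
  refine ⟨Submodule.span ℝ (Set.range g), hfin, ?_⟩
  calc ∫⁻ ω, ‖X ω - (Submodule.span ℝ (Set.range g)).starProjection (X ω)‖ₑ ^ 2 ∂P
      ≤ ∫⁻ ω, ‖X ω - g ω‖ₑ ^ 2 ∂P := by
        refine lintegral_mono fun ω => pow_le_pow_left' ?_ 2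
        rw [enorm_le_iff_norm_le, Submodule.starProjection_minimal]
        exact ciInf_le ⟨0, by rintro _ ⟨y, rfl⟩; exact norm_nonneg _⟩
          (⟨g ω, Submodule.subset_span ⟨ω, rfl⟩⟩ : Submodule.span ℝ (Set.range g))
    _ = eLpNorm (X - ⇑g) 2 P ^ 2 := by
        rw [eLpNorm_eq_lintegral_rpow_enorm_toReal (by simp) (by simp), ← ENNReal.rpow_natCast,
          ← ENNReal.rpow_mul]
        simp
    _ ≤ ε := (pow_le_pow_left' hg.le 2).trans hδε

/-! ### Central limit theorem in a separable Hilbert space. -/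

section HilbertCLT

variable {Ω : Type*} {mΩ : MeasurableSpace Ω} {P : Measure Ω} [IsProbabilityMeasure P]
  {E : Type*} [NormedAddCommGroup E] [InnerProductSpace ℝ E] [CompleteSpace E]
  [SecondCountableTopology E] [MeasurableSpace E] [BorelSpace E]

/-- Equality holds for `n ≥ 1`; the inequality also covers the empty sum at `n = 0`. -/
theorem lintegral_enorm_sq_inv_sqrt_smul_sum_le {X : ℕ → Ω → E} (hindep : iIndepFun X P)
    (hident : ∀ i, IdentDistrib (X i) (X 0) P P) (hX : MemLp (X 0) 2 P)
    (h0 : ∫ ω, X 0 ω ∂P = 0) (n : ℕ) :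
    ∫⁻ ω, ‖(√n)⁻¹ • ∑ k ∈ Finset.range n, X k ω‖ₑ ^ 2 ∂P ≤ ∫⁻ ω, ‖X 0 ω‖ₑ ^ 2 ∂P := by
  have hXi (i : ℕ) : MemLp (X i) 2 P := (hident i).memLp_iff.2 hX
  have hsum : MemLp (fun ω => ∑ k ∈ Finset.range n, X k ω) 2 P :=
    memLp_finsetSum _ fun k _ => hXi k
  have hnorm (i : ℕ) : ∫ ω, ‖X i ω‖ ^ 2 ∂P = ∫ ω, ‖X 0 ω‖ ^ 2 ∂P :=
    ((hident i).comp (u := fun x => ‖x‖ ^ 2) (by fun_prop)).integral_eq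
  rw [lintegral_enorm_sq_eq_ofReal_integral (X := fun ω => (√n)⁻¹ • ∑ k ∈ Finset.range n, X k ω)
    (hsum.const_smul _), lintegral_enorm_sq_eq_ofReal_integral hX]
  refine ENNReal.ofReal_le_ofReal ?_
  simp_rw [norm_smul, mul_pow]
  rw [integral_const_mul, hindep.integral_norm_sq_sum hXi
    fun i => (hident i).integral_eq.trans h0]
  simp_rw [hnorm]
  rw [Finset.sum_const, Finset.card_range, nsmul_eq_mul, ← mul_assoc]
  refine mul_le_of_le_one_left (integral_nonneg fun _ => sq_nonneg _) ?_
  rcases Nat.eq_zero_or_pos n with rfl | hn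
  · simp
  · have : (0 : ℝ) < n := by exact_mod_cast hn
    rw [norm_inv, Real.norm_of_nonneg (Real.sqrt_nonneg _), inv_pow, Real.sq_sqrt this.le,
      inv_mul_cancel₀ this.ne']

/-- The residual map `1 - V.starProjection` is linear, so it commutes with normalised sums, and a
subspace adapted to `X 0` alone serves every `n`. -/
theorem isTightMeasureSet_map_inv_sqrt_smul_sum {X : ℕ → Ω → E} (hindep : iIndepFun X P)
    (hident : ∀ i, IdentDistrib (X i) (X 0) P P) (hX : MemLp (X 0) 2 P)
    (h0 : ∫ ω, X 0 ω ∂P = 0) :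
    IsTightMeasureSet
      (Set.range fun n : ℕ => P.map fun ω => (√n)⁻¹ • ∑ k ∈ Finset.range n, X k ω) := by
  have hmeas (n : ℕ) : AEMeasurable (fun ω => (√n)⁻¹ • ∑ k ∈ Finset.range n, X k ω) P :=
    (Finset.aemeasurable_fun_sum _ fun k _ => (hident k).aemeasurable_fst).const_smul _
  refine isTightMeasureSet_of_lintegral_sub_starProjection
    (M := ∫⁻ ω, ‖X 0 ω‖ₑ ^ 2 ∂P) ?_ ?_ fun ε hε => ?_
  · rw [lintegral_enorm_sq_eq_ofReal_integral hX]
    exact ENNReal.ofReal_ne_top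
  · rintro _ ⟨n, rfl⟩
    rw [lintegral_map' (by fun_prop) (hmeas n)]
    exact lintegral_enorm_sq_inv_sqrt_smul_sum_le hindep hident hX h0 n
  · obtain ⟨V, hfin, hV⟩ := hX.exists_finiteDimensional_lintegral_sub_starProjection_le hε
    refine ⟨V, hfin, ?_⟩
    rintro _ ⟨n, rfl⟩
    let L : E →L[ℝ] E := ContinuousLinearMap.id ℝ E - V.starProjection
    have hL (x : E) : x - V.starProjection x = L x := rfl
    have hLm : Measurable L := L.continuous.measurable
    simp_rw [hL] at hV ⊢
    rw [lintegral_map' (by fun_prop) (hmeas n)]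
    simp_rw [map_smul, map_sum]
    refine (lintegral_enorm_sq_inv_sqrt_smul_sum_le (X := fun k ω => L (X k ω))
      (hindep.comp (fun _ => L) fun _ => hLm) (fun i => (hident i).comp hLm)
      (L.comp_memLp' hX) ?_ n).trans hV
    rw [L.integral_comp_comm (hX.integrable (by simp)), h0, map_zero]

theorem tendsto_charFun_map_inv_sqrt_smul_sum {X : ℕ → Ω → E} (hindep : iIndepFun X P)
    (hident : ∀ i, IdentDistrib (X i) (X 0) P P) (hX : MemLp (X 0) 2 P)
    (h0 : ∫ ω, X 0 ω ∂P = 0) (t : E) :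
    Tendsto (fun n : ℕ => charFun (P.map fun ω => (√n)⁻¹ • ∑ k ∈ Finset.range n, X k ω) t) atTop
      (𝓝 (Complex.exp (-(covarianceBilin (P.map (X 0)) t t : ℝ) / 2))) := by
  have hmeas (n : ℕ) : AEMeasurable (fun ω => (√n)⁻¹ • ∑ k ∈ Finset.range n, X k ω) P :=
    (Finset.aemeasurable_fun_sum _ fun k _ => (hident k).aemeasurable_fst).const_smul _
  have hX0 : AEMeasurable (X 0) P := (hident 0).aemeasurable_fst
  have hmean : ∫ ω, ⟪t, X 0 ω⟫ ∂P = 0 := by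
    rw [integral_inner (hX.integrable (by simp)), h0, inner_zero_right]
  have hcov : covarianceBilin (P.map (X 0)) t t = Var[fun ω => ⟪t, X 0 ω⟫; P] := by
    have := Measure.isProbabilityMeasure_map hX0
    rw [covarianceBilin_self ((memLp_map_measure_iff (by fun_prop) hX0).2 hX),
      variance_map (by fun_prop) hX0]
    rfl
  have hclt := tendstoInDistribution_inv_sqrt_mul_sum_sub (X := fun k ω => ⟪t, X k ω⟫) (P := P)
    (Y := id) (P' := gaussianReal 0 Var[fun ω => ⟪t, X 0 ω⟫; P].toNNReal) ⟨by fun_prop, by simp⟩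
    (hX.const_inner t) (hindep.comp (fun _ x => ⟪t, x⟫) fun _ => by fun_prop)
    (fun i => (hident i).comp (u := fun x => ⟪t, x⟫) (by fun_prop))
  -- The characteristic function at `t` of the vector sum is that of its scalar projection along
  -- `t`, evaluated at `1`.
  have h := ProbabilityMeasure.tendsto_iff_tendsto_charFun.1 hclt.tendsto 1
  simp only [ProbabilityMeasure.coe_mk, Measure.map_id, charFun_gaussianReal] at h
  rw [hcov]
  convert h using 2 with n
  · simp only [hmean, mul_zero, sub_zero]
    rw [charFun_apply, charFun_apply, integral_map (hmeas n) (by fun_prop), integral_map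
      (by have := hmeas n; have := fun k => (hident k).aemeasurable_fst; fun_prop) (by fun_prop)]
    simp [real_inner_comm t, inner_smul_right, inner_sum]
  · simp [variance_nonneg]
    ring_nf

/-- **Central limit theorem** in a separable Hilbert space. -/
theorem exists_isGaussian_tendstoInDistribution_inv_sqrt_smul_sum {X : ℕ → Ω → E}
    (hindep : iIndepFun X P) (hident : ∀ i, IdentDistrib (X i) (X 0) P P)
    (hX : MemLp (X 0) 2 P) (h0 : ∫ ω, X 0 ω ∂P = 0) :
    ∃ (γ : Measure E) (_ : IsProbabilityMeasure γ), IsGaussian γ ∧ ∫ z, z ∂γ = 0 ∧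
      covarianceBilin γ = covarianceBilin (P.map (X 0)) ∧
      TendstoInDistribution (fun (n : ℕ) ω => (√n)⁻¹ • ∑ k ∈ Finset.range n, X k ω) atTop id
        (fun _ => P) γ := by
  have hmeas (n : ℕ) : AEMeasurable (fun ω => (√n)⁻¹ • ∑ k ∈ Finset.range n, X k ω) P :=
    (Finset.aemeasurable_fun_sum _ fun k _ => (hident k).aemeasurable_fst).const_smul _
  let μ : ℕ → ProbabilityMeasure E := fun n =>
    ⟨P.map fun ω => (√n)⁻¹ • ∑ k ∈ Finset.range n, X k ω,
      Measure.isProbabilityMeasure_map (hmeas n)⟩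
  have htight : IsTightMeasureSet {(μ n : Measure E) | n} :=
    isTightMeasureSet_map_inv_sqrt_smul_sum hindep hident hX h0
  have hchar (t : E) := tendsto_charFun_map_inv_sqrt_smul_sum hindep hident hX h0 t
  have hcompact : IsCompact (closure (Set.range μ)) :=
    isCompact_closure_of_isTightMeasureSet (by simpa using htight)
  -- A limit along an ultrafilter finer than `atTop` exists by compactness, and its characteristic
  -- function must be the known pointwise limit.
  let F : Ultrafilter ℕ := Ultrafilter.of atTop
  have hF : (F : Filter ℕ) ≤ atTop := Ultrafilter.of_le _
  obtain ⟨γ, -, hγ : Tendsto μ F (𝓝 γ)⟩ := hcompact.ultrafilter_le_nhds (F.map μ)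
    (le_principal_iff.2 (mem_map.2 (univ_mem' fun n => subset_closure ⟨n, rfl⟩)))
  have hcharγ (t : E) : charFun (γ : Measure E) t =
      Complex.exp (⟪t, (0 : E)⟫ * Complex.I
        - (covarianceBilin (P.map (X 0)) t t : ℝ) / 2) := by
    rw [inner_zero_right, Complex.ofReal_zero, zero_mul, zero_sub, ← neg_div]
    refine tendsto_nhds_unique ?_ ((hchar t).mono_left hF)
    rw [ProbabilityMeasure.tendsto_iff_forall_integral_rclike_tendsto ℂ] at hγ
    simp_rw [charFun_eq_integral_innerProbChar]
    exact hγ (BoundedContinuousFunction.innerProbChar t)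
  have hgauss : IsGaussian (γ : Measure E) :=
    isGaussian_iff_gaussian_charFun.2 ⟨0, _, isPosSemidef_covarianceBilin, hcharγ⟩
  obtain ⟨hmean, hcov⟩ := gaussian_charFun_congr 0 _ isPosSemidef_covarianceBilin hcharγ
  refine ⟨γ, inferInstance, hgauss, hmean.symm, hcov.symm, hmeas, by fun_prop, ?_⟩
  -- Tightness upgrades convergence on trigonometric polynomials, which separate points, to weak
  -- convergence of the whole sequence.
  have hlim : Tendsto μ atTop (𝓝 γ) := by
    refine ProbabilityMeasure.tendsto_of_tight_of_separatesPoints ℂ htight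
      (A := BoundedContinuousFunction.charPoly Real.continuous_probChar
        (L := innerₗ E) continuous_inner) ?_ ?_
    · refine BoundedContinuousFunction.separatesPoints_charPoly Real.continuous_probChar
        Real.probChar_ne_one _ ?_
      exact fun v hv => DFunLike.ne_iff.mpr ⟨v, inner_self_ne_zero.mpr hv⟩
    · refine fun g hg => ProbabilityMeasure.tendsto_charPoly_of_tendsto_charFun (fun t => ?_) hg
      rw [hcharγ t, inner_zero_right, Complex.ofReal_zero, zero_mul, zero_sub, ← neg_div]
      exact hchar t
  convert hlim using 2
  exact congrArg 𝓝 (Subtype.ext Measure.map_id)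

end HilbertCLT

/-! ### Norm, continuity and measurability of `g ⊗ g`. -/

section TensorSelf

variable {H : Type*} [NormedAddCommGroup H] [InnerProductSpace ℝ H] [CompleteSpace H]

namespace HilbertSchmidt

/-- Parseval's identity for `y`. -/
theorem norm_mk_rankOne (x y : H) :
    ‖mk (rankOne ℝ x y) (isHilbertSchmidt_rankOne x y)‖ = ‖x‖ * ‖y‖ := by
  rw [← sq_eq_sq₀ (norm_nonneg _) (by positivity), norm_sq_eq_tsum (hsBasis H)]
  have h := ((hsBasis H).hasSum_inner_mul_inner y y).mul_right (‖x‖ ^ 2)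
  rw [real_inner_self_eq_norm_sq] at h
  rw [mul_pow, mul_comm (‖x‖ ^ 2), ← h.tsum_eq]
  refine tsum_congr fun i => ?_
  rw [toCLM_mk, rankOne_apply, norm_smul, mul_pow, Real.norm_eq_abs, sq_abs,
    real_inner_comm (hsBasis H i) y, sq ⟪hsBasis H i, y⟫]

theorem norm_tensorSelf (g : H) : ‖tensorSelf g‖ = ‖g‖ ^ 2 := by
  rw [tensorSelf, norm_mk_rankOne, sq]

theorem tensorSelf_sub_tensorSelf (g h : H) :
    tensorSelf g - tensorSelf h =
      mk (rankOne ℝ (g - h) g) (isHilbertSchmidt_rankOne _ _) +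
        mk (rankOne ℝ h (g - h)) (isHilbertSchmidt_rankOne _ _) := by
  apply toCLM_injective
  simp [tensorSelf]

theorem continuous_tensorSelf : Continuous (tensorSelf : H → HilbertSchmidt H) := by
  refine continuous_iff_continuousAt.2 fun h => ?_
  rw [ContinuousAt, tendsto_iff_norm_sub_tendsto_zero]
  have hbound : Tendsto (fun g : H => ‖g - h‖ * ‖g‖ + ‖h‖ * ‖g - h‖) (𝓝 h) (𝓝 0) := by
    have : Continuous fun g : H => ‖g - h‖ * ‖g‖ + ‖h‖ * ‖g - h‖ := by fun_prop
    simpa using this.tendsto h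
  refine squeeze_zero (fun _ => norm_nonneg _) (fun g => ?_) hbound
  rw [tensorSelf_sub_tensorSelf, ← norm_mk_rankOne, ← norm_mk_rankOne]
  exact norm_add_le _ _

/-- The contraction of `S₂(H)` into the bounded operators. -/
noncomputable def toCLMContinuous : HilbertSchmidt H →L[ℝ] (H →L[ℝ] H) :=
  toCLM.mkContinuous 1 fun A => by simpa using norm_toCLM_le A

theorem toCLMContinuous_apply (A : HilbertSchmidt H) : toCLMContinuous A = toCLM A := rfl

end HilbertSchmidt

/-- No regularity of `f` is needed: the differentiability set is Borel and `fderiv` is `0` off it.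
-/
theorem measurable_gradient [MeasurableSpace H] [BorelSpace H] (f : H → ℝ) :
    Measurable (∇ f) :=
  (toDual ℝ H).symm.continuous.measurable.comp (measurable_fderiv ℝ f)

end TensorSelf

/-! ### Covariance operators as Bochner integrals. -/

section Covariance

variable {Ω : Type*} {mΩ : MeasurableSpace Ω} {P : Measure Ω}
  {E : Type*} [NormedAddCommGroup E] [InnerProductSpace ℝ E]

theorem MeasureTheory.MemLp.integrable_rankOne_self {X : Ω → E} (hX : MemLp X 2 P) :
    Integrable (fun ω => rankOne ℝ (X ω) (X ω)) P := by
  refine (hX.integrable_norm_pow (by simp)).mono' ?_ (ae_of_all _ fun ω => ?_)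
  · exact ((rankOne ℝ).continuous.clm_apply continuous_id).comp_aestronglyMeasurable hX.1
  · rw [norm_rankOne, sq]

variable [CompleteSpace E] [MeasurableSpace E] [BorelSpace E]

theorem covarianceOperator_map [SecondCountableTopology E] {X : Ω → E} (hX : MemLp X 2 P) :
    covarianceOperator (P.map X) = ∫ ω, rankOne ℝ (X ω) (X ω) ∂P := by
  have hXm : AEMeasurable X P := hX.1.aemeasurable
  ext x
  refine ext_inner_right ℝ fun y => ?_
  rw [covarianceOperator_inner ((memLp_map_measure_iff (by fun_prop) hXm).2 hX),
    integral_map hXm (by fun_prop),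
    ContinuousLinearMap.integral_apply hX.integrable_rankOne_self, real_inner_comm,
    ← integral_inner (hX.integrable_rankOne_self.apply_continuousLinearMap x)]
  refine integral_congr_ae (ae_of_all _ fun ω => ?_)
  simp only [rankOne_apply, inner_smul_right]
  rw [real_inner_comm x]

/-- `covarianceBilin` is centred whereas `covarianceOperator` is not; the two carry the same
information once the means vanish. -/
theorem covarianceOperator_eq_of_covarianceBilin_eq {μ ν : Measure E} [IsFiniteMeasure μ]
    [IsFiniteMeasure ν] (hμ : MemLp id 2 μ) (hν : MemLp id 2 ν) (hμ0 : ∫ x, x ∂μ = 0)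
    (hν0 : ∫ x, x ∂ν = 0) (h : covarianceBilin μ = covarianceBilin ν) :
    covarianceOperator μ = covarianceOperator ν := by
  ext x
  refine ext_inner_right ℝ fun y => ?_
  have hxy := congr($h x y)
  rw [covarianceBilin_apply hμ, covarianceBilin_apply hν] at hxy
  rw [covarianceOperator_inner hμ, covarianceOperator_inner hν]
  simpa [hμ0, hν0] using hxy

end Covariance

/-! ### The limit theorem for the empirical operator. -/

theorem mainTheorem7 {H : Type*} [NormedAddCommGroup H] [InnerProductSpace ℝ H] [CompleteSpace H]
    [TopologicalSpace.SeparableSpace H] [MeasurableSpace H] [BorelSpace H]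
    {Ω : Type*} [MeasurableSpace Ω] (P : Measure Ω) [IsProbabilityMeasure P]
    (ρ : Measure H) [IsProbabilityMeasure ρ]
    (D : Set H) (hD : IsOpen D) (f : H → ℝ)
    (hf : ∀ᵐ u ∂ρ, u ∈ D ∧ DifferentiableAt ℝ f u)
    (hmom : Integrable (fun u => ‖∇ f u‖ ^ 4) ρ)
    (U : ℕ → Ω → H) (hlaw : ∀ b, HasLaw (U b) ρ P) (hindep : iIndepFun U P) :
    Integrable (fun u => rankOne ℝ (∇ f u) (∇ f u)) ρ ∧
    ∃ C : HilbertSchmidt H, C.toCLM = activeSubspaceOperator f ρ ∧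
      Integrable (fun u => rankOne ℝ (HilbertSchmidt.tensorSelf (∇ f u) - C)
        (HilbertSchmidt.tensorSelf (∇ f u) - C)) ρ ∧
      ∃ (γ : Measure (HilbertSchmidt H)) (_ : IsProbabilityMeasure γ),
        IsGaussian γ ∧ MemLp id 2 γ ∧ ∫ z, z ∂γ = 0 ∧
        covarianceOperator γ =
          ∫ u, rankOne ℝ (HilbertSchmidt.tensorSelf (∇ f u) - C)
            (HilbertSchmidt.tensorSelf (∇ f u) - C) ∂ρ ∧
        TendstoInDistribution
          (fun (B : ℕ) ω => √(B : ℝ) • (empiricalOperator f (fun b => U b ω) B - C))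
          atTop id (fun _ => P) γ := by
  have : SecondCountableTopology H := UniformSpace.secondCountable_of_separable H
  have : SecondCountableTopology (HilbertSchmidt H) :=
    UniformSpace.secondCountable_of_separable (HilbertSchmidt H)
  let T : H → HilbertSchmidt H := fun u => HilbertSchmidt.tensorSelf (∇ f u)
  have hTm : Measurable T :=
    HilbertSchmidt.continuous_tensorSelf.measurable.comp (measurable_gradient f)
  have hT : MemLp T 2 ρ := by
    refine (memLp_two_iff_integrable_sq_norm hTm.aestronglyMeasurable).2 ?_
    refine hmom.congr (ae_of_all _ fun u => ?_)
    simp only [T, HilbertSchmidt.norm_tensorSelf]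
    ring
  have hTint : Integrable T ρ := hT.integrable (by simp)
  -- `C` is the Bochner integral taken in `S₂(H)`; the contraction into bounded operators commutes
  -- with integration, so it sends `C` to the operator-norm integral.
  refine ⟨HilbertSchmidt.toCLMContinuous.integrable_comp hTint, ∫ u, T u ∂ρ,
    (HilbertSchmidt.toCLMContinuous.integral_comp_comm hTint).symm, ?_⟩
  set C : HilbertSchmidt H := ∫ u, T u ∂ρ
  let X : H → HilbertSchmidt H := fun u => T u - C
  have hXm : Measurable X := hTm.sub_const C
  have hX : MemLp X 2 ρ := hT.sub (memLp_const C)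
  have hX0 : ∫ u, X u ∂ρ = 0 := by
    rw [integral_sub hTint (integrable_const C)]
    simp [C]
  have hlawX : P.map (X ∘ U 0) = ρ.map X := by
    rw [← AEMeasurable.map_map_of_aemeasurable hXm.aemeasurable (hlaw 0).aemeasurable,
      (hlaw 0).map_eq]
  have hid (i : ℕ) : IdentDistrib (U i) (U 0) P P :=
    ⟨(hlaw i).aemeasurable, (hlaw 0).aemeasurable, by rw [(hlaw i).map_eq, (hlaw 0).map_eq]⟩
  have hmeasU := (hlaw 0).aemeasurable
  obtain ⟨γ, hγ, hgauss, hmean, hcov, hconv⟩ :=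
    exists_isGaussian_tendstoInDistribution_inv_sqrt_smul_sum (X := fun k => X ∘ U k)
      (hindep.comp (fun _ => X) fun _ => hXm) (fun i => (hid i).comp hXm)
      ((memLp_map_measure_iff (by fun_prop) hmeasU).1 (by rwa [(hlaw 0).map_eq]))
      (by
        rw [← hX0, ← (hlaw 0).map_eq, integral_map hmeasU (by fun_prop)]
        rfl)
  have hXlaw : MemLp id 2 (ρ.map X) :=
    (memLp_map_measure_iff (by fun_prop) hXm.aemeasurable).2 hX
  have := Measure.isProbabilityMeasure_map (μ := ρ) hXm.aemeasurable
  have hγ2 : MemLp id 2 γ := IsGaussian.memLp_two_id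
  refine ⟨hX.integrable_rankOne_self, γ, hγ, hgauss, hγ2, hmean, ?_, ?_⟩
  · refine (covarianceOperator_eq_of_covarianceBilin_eq hγ2 hXlaw hmean ?_ ?_).trans
      (covarianceOperator_map hX)
    · rw [integral_map hXm.aemeasurable (by fun_prop), hX0]
    · rw [hcov, hlawX]
  -- The scalings match because `√B / B = (√B)⁻¹` and `B / √B = √B`, both true at `B = 0` since
  -- division by zero gives zero.
  · refine hconv.congr (fun n => ae_of_all _ fun ω => ?_) (ae_of_all _ fun _ => rfl)
    simp only [X, T, Function.comp_apply, empiricalOperator, Finset.sum_sub_distrib,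
      Finset.sum_const, Finset.card_range, smul_sub, smul_smul]
    rw [← Nat.cast_smul_eq_nsmul ℝ, smul_smul]
    congr 2
    · rw [← div_eq_mul_inv, Real.sqrt_div_self]
    · rw [inv_mul_eq_div, Real.div_sqrt]
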